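/- Let $(\Omega,\mathcal F,P)$ be a probability space, $H$ a separable real Hilbert space with inner product $(\cdot,\cdot)_H$, and $\mathcal H$ the Hilbert space of Hilbert--Schmidt operators on $H$. Call $\mathcal T\in\mathcal H$ non-negative definite if $(\mathcal Tf,f)_H\ge 0$ for all $f\in H$, and let $\mathcal H_+\subset\mathcal H$ be the convex cone of non-negative definite operators. Let $\mathbb C$ be a bounded linear operator from $\mathcal H$ into itself, with semigroup $\mathbb S(t)=\exp(t\mathbb C)$, $t\ge 0$, and assume that $\mathbb C(\mathcal H_+)\subset\mathcal H_+$, or that $\mathbb S(t)(\mathcal H_+)\subset\mathcal H_+$ for all $t\ge 0$. Let $\mathcal L$ be a square-integrable $\mathcal H$-valued Lévy process with non-decreasing paths, i.e. each $\mathcal L(t)$ is almost surely self-adjoint, and for every $f\in H$ the path $t\mapsto(\mathcal L(t)f,f)_H$ is almost surely non-decreasing on $[0,\infty)$. Let $\mathcal Y_0\in\mathcal H_+$, and let $\mathcal Y=(\mathcal Y(t))_{t\ge 0}$ be an $\mathcal H$-valued solution of $$d\mathcal Y(t)=\mathbb C\mathcal Y(t)\,dt+d\mathcal L(t),\qquad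 \mathcal Y(0)=\mathcal Y_0 .$$ Then $\mathcal Y$ is non-negative definite. Precisely: 1. If $\mathcal Y$ is a mild solution, i.e. for every $t\ge0$, almost surely, $\mathcal Y(t)=\mathbb S(t)\mathcal Y_0+\int_0^t\mathbb S(t-s)\,d\mathcal L(s)$, the stochastic integral being the $L^2(\Omega;\mathcal H)$-limit of the sums $\sum_m\mathbb S(t-s_m)(\mathcal L(s_{m+1})-\mathcal L(s_m))$ over partitions of $[0,t]$ as the mesh tends to $0$, then for every $t\ge 0$, almost surely, $\mathcal Y(t)\in\mathcal H_+$. 2. If almost surely, for all $t\ge0$, $\mathcal Y$ is Bochner integrable on $[0,t]$ and $\mathcal Y(t)=\mathcal Y_0+\int_0^t\mathbb C\mathcal Y(s)\,ds+\mathcal L(t)$, then almost surely $\mathcal Y(t)\in\mathcal H_+$ for all $t\ge 0$. -/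

import Mathlib

open MeasureTheory ProbabilityTheory Filter Topology
open scoped NNReal ENNReal InnerProductSpace

noncomputable section

/-! ### The Hilbert space of Hilbert–Schmidt operators -/

section HilbertSchmidt

variable (H : Type*) [NormedAddCommGroup H] [InnerProductSpace ℝ H] [CompleteSpace H]

/-- The index set of a fixed orthonormal basis of `H`. -/
def hsIndex : Set H := (exists_hilbertBasis ℝ H).choose

/-- A fixed orthonormal basis of `H`. Nothing below depends on this choice, see
`isHilbertSchmidt_iff` and `HilbertSchmidt.hasSum_norm_sq`, `HilbertSchmidt.hasSum_inner`. -/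
def hsBasis : HilbertBasis (hsIndex H) ℝ H := (exists_hilbertBasis ℝ H).choose_spec.choose

variable {H}

/-- A bounded operator `T` is Hilbert–Schmidt if `∑ ‖T eᵢ‖² < ∞` for an orthonormal basis. -/
def IsHilbertSchmidt (T : H →L[ℝ] H) : Prop :=
  Summable fun i => ‖T (hsBasis H i)‖ ^ 2

theorem HilbertBasis.tsum_enorm_sq {ι H : Type*} [NormedAddCommGroup H] [InnerProductSpace ℝ H]
    (b : HilbertBasis ι ℝ H) (x : H) :
    ∑' i, ENNReal.ofReal (⟪x, b i⟫_ℝ ^ 2) = ENNReal.ofReal (‖x‖ ^ 2) := by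
  have h := b.hasSum_inner_mul_inner x x
  have h' : HasSum (fun i => ⟪x, b i⟫_ℝ ^ 2) (‖x‖ ^ 2) := by
    rw [← real_inner_self_eq_norm_sq]
    simpa only [real_inner_comm, sq] using h
  rw [← h'.tsum_eq, ENNReal.ofReal_tsum_of_nonneg (fun i => sq_nonneg _) h'.summable]

theorem tsum_enorm_sq_adjoint {ι κ : Type*} (b : HilbertBasis ι ℝ H) (c : HilbertBasis κ ℝ H)
    (T : H →L[ℝ] H) :
    ∑' i, ENNReal.ofReal (‖T (b i)‖ ^ 2) =
      ∑' j, ENNReal.ofReal (‖ContinuousLinearMap.adjoint T (c j)‖ ^ 2) := by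
  calc ∑' i, ENNReal.ofReal (‖T (b i)‖ ^ 2)
      = ∑' i, ∑' j, ENNReal.ofReal (⟪T (b i), c j⟫_ℝ ^ 2) := by
        simp_rw [c.tsum_enorm_sq]
    _ = ∑' j, ∑' i, ENNReal.ofReal (⟪ContinuousLinearMap.adjoint T (c j), b i⟫_ℝ ^ 2) := by
        rw [ENNReal.tsum_comm]
        simp_rw [ContinuousLinearMap.adjoint_inner_left, real_inner_comm]
    _ = _ := by simp_rw [b.tsum_enorm_sq]

theorem tsum_enorm_sq_basis {ι κ : Type*} (b : HilbertBasis ι ℝ H) (c : HilbertBasis κ ℝ H)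
    (T : H →L[ℝ] H) :
    ∑' i, ENNReal.ofReal (‖T (b i)‖ ^ 2) = ∑' j, ENNReal.ofReal (‖T (c j)‖ ^ 2) := by
  rw [tsum_enorm_sq_adjoint b c, ← tsum_enorm_sq_adjoint c c]

theorem summable_iff_tsum_ofReal_ne_top {ι : Type*} {f : ι → ℝ} (hf : ∀ i, 0 ≤ f i) :
    Summable f ↔ ∑' i, ENNReal.ofReal (f i) ≠ ∞ := by
  refine ⟨fun h => h.tsum_ofReal_ne_top, fun h => ?_⟩
  refine (ENNReal.summable_toReal h).congr fun i => ?_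
  exact ENNReal.toReal_ofReal (hf i)

/-- The Hilbert–Schmidt property does not depend on the orthonormal basis. -/
theorem isHilbertSchmidt_iff {ι : Type*} (b : HilbertBasis ι ℝ H) (T : H →L[ℝ] H) :
    IsHilbertSchmidt T ↔ Summable fun i => ‖T (b i)‖ ^ 2 := by
  rw [IsHilbertSchmidt, summable_iff_tsum_ofReal_ne_top fun _ => sq_nonneg _,
    summable_iff_tsum_ofReal_ne_top fun _ => sq_nonneg _, tsum_enorm_sq_basis (hsBasis H) b]

theorem IsHilbertSchmidt.memlp {T : H →L[ℝ] H} (hT : IsHilbertSchmidt T) :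
    Memℓp (fun i => T (hsBasis H i)) 2 :=
  memℓp_gen (by simpa using (show Summable _ from hT))

theorem isHilbertSchmidt_iff_memlp {T : H →L[ℝ] H} :
    IsHilbertSchmidt T ↔ Memℓp (fun i => T (hsBasis H i)) 2 := by
  refine ⟨fun h => h.memlp, fun h => ?_⟩
  rw [IsHilbertSchmidt]
  simpa using h.summable (by norm_num)

variable (H)

/-- The Hilbert–Schmidt operators as a subspace of the bounded operators. -/
def hsSubmodule : Submodule ℝ (H →L[ℝ] H) where
  carrier := {T | IsHilbertSchmidt T}
  add_mem' hS hT := isHilbertSchmidt_iff_memlp.2 (hS.memlp.add hT.memlp)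
  zero_mem' := isHilbertSchmidt_iff_memlp.2 zero_memℓp
  smul_mem' c _ hT := isHilbertSchmidt_iff_memlp.2 (hT.memlp.const_smul c)

/-- The space of Hilbert–Schmidt operators on `H`, to be normed by the Hilbert–Schmidt norm. -/
def HilbertSchmidt : Type _ := ↥(hsSubmodule H)

instance : AddCommGroup (HilbertSchmidt H) := inferInstanceAs (AddCommGroup ↥(hsSubmodule H))

instance : Module ℝ (HilbertSchmidt H) := inferInstanceAs (Module ℝ ↥(hsSubmodule H))

namespace HilbertSchmidt

/-- The underlying bounded operator. -/
def toCLM : HilbertSchmidt H →ₗ[ℝ] (H →L[ℝ] H) := (hsSubmodule H).subtype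

instance : CoeFun (HilbertSchmidt H) fun _ => H → H := ⟨fun T => toCLM H T⟩

variable {H}

theorem toCLM_injective : Function.Injective (toCLM H) := Subtype.val_injective

theorem isHilbertSchmidt (T : HilbertSchmidt H) : IsHilbertSchmidt (toCLM H T) := T.2

theorem exists_toCLM_eq {T : H →L[ℝ] H} (hT : IsHilbertSchmidt T) :
    ∃ S : HilbertSchmidt H, toCLM H S = T := ⟨⟨T, hT⟩, rfl⟩

variable (H)

/-- The map `T ↦ (T eᵢ)ᵢ` into the Hilbert sum `ℓ²(H)`. -/
def toLp : HilbertSchmidt H →ₗ[ℝ] lp (fun _ : hsIndex H => H) 2 where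
  toFun T := ⟨fun i => T (hsBasis H i), T.isHilbertSchmidt.memlp⟩
  map_add' _ _ := rfl
  map_smul' _ _ := rfl

variable {H}

theorem toLp_apply (T : HilbertSchmidt H) (i : hsIndex H) : toLp H T i = T (hsBasis H i) := rfl

theorem toLp_injective : Function.Injective (toLp H) := by
  intro S T h
  apply toCLM_injective
  apply ContinuousLinearMap.ext_on
    (s := Set.range (hsBasis H)) (Submodule.dense_iff_topologicalClosure_eq_top.2
      (hsBasis H).dense_span)
  rintro _ ⟨i, rfl⟩
  simpa [toLp_apply] using congrArg (fun f : lp (fun _ : hsIndex H => H) 2 => f i) h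

instance : NormedAddCommGroup (HilbertSchmidt H) :=
  NormedAddCommGroup.induced (HilbertSchmidt H) (lp (fun _ : hsIndex H => H) 2) (toLp H)
    toLp_injective

theorem norm_eq_norm_toLp (T : HilbertSchmidt H) : ‖T‖ = ‖toLp H T‖ := rfl

instance : NormedSpace ℝ (HilbertSchmidt H) :=
  NormedSpace.induced ℝ (HilbertSchmidt H) (lp (fun _ : hsIndex H => H) 2) (toLp H)

/-- The Hilbert–Schmidt inner product `⟪S, T⟫ = ∑ ⟪S eᵢ, T eᵢ⟫`. -/
instance : InnerProductSpace ℝ (HilbertSchmidt H) where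
  inner S T := ∑' i, ⟪S (hsBasis H i), T (hsBasis H i)⟫_ℝ
  norm_sq_eq_re_inner T := InnerProductSpace.norm_sq_eq_re_inner (𝕜 := ℝ) (toLp H T)
  conj_inner_symm S T := InnerProductSpace.conj_inner_symm (𝕜 := ℝ) (toLp H S) (toLp H T)
  add_left S T U :=
    InnerProductSpace.add_left (𝕜 := ℝ) (toLp H S) (toLp H T) (toLp H U)
  smul_left S T r := InnerProductSpace.smul_left (𝕜 := ℝ) (toLp H S) (toLp H T) r

/-- The isometric embedding `T ↦ (T eᵢ)ᵢ`. -/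
def toLpₗᵢ : HilbertSchmidt H →ₗᵢ[ℝ] lp (fun _ : hsIndex H => H) 2 where
  toLinearMap := toLp H
  norm_map' _ := rfl

/-- `‖T‖² = ∑ ‖T bᵢ‖²` for every orthonormal basis `b`. -/
theorem hasSum_norm_sq {ι : Type*} (b : HilbertBasis ι ℝ H) (T : HilbertSchmidt H) :
    HasSum (fun i => ‖T (b i)‖ ^ 2) (‖T‖ ^ 2) := by
  have hs := (isHilbertSchmidt_iff b _).1 T.isHilbertSchmidt
  have hs' : Summable fun i => ‖T (hsBasis H i)‖ ^ 2 := T.isHilbertSchmidt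
  have h0 : ‖T‖ ^ 2 = ∑' i, ‖T (hsBasis H i)‖ ^ 2 := by
    rw [← real_inner_self_eq_norm_sq]
    exact tsum_congr fun i => real_inner_self_eq_norm_sq _
  have h1 : ∑' i, ‖T (hsBasis H i)‖ ^ 2 = ∑' i, ‖T (b i)‖ ^ 2 := by
    have := tsum_enorm_sq_basis (hsBasis H) b (toCLM H T)
    rw [← ENNReal.ofReal_tsum_of_nonneg (fun _ => sq_nonneg _) hs',
      ← ENNReal.ofReal_tsum_of_nonneg (fun _ => sq_nonneg _) hs] at this
    exact (ENNReal.ofReal_eq_ofReal_iff (tsum_nonneg fun _ => sq_nonneg _)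
      (tsum_nonneg fun _ => sq_nonneg _)).1 this
  rw [h0, h1]
  exact hs.hasSum

/-- `⟪S, T⟫ = ∑ ⟪S bᵢ, T bᵢ⟫` for every orthonormal basis `b`. -/
theorem hasSum_inner {ι : Type*} (b : HilbertBasis ι ℝ H) (S T : HilbertSchmidt H) :
    HasSum (fun i => ⟪S (b i), T (b i)⟫_ℝ) ⟪S, T⟫_ℝ := by
  have h := ((hasSum_norm_sq b (S + T)).sub (hasSum_norm_sq b (S - T))).div_const 4
  have e : (‖S + T‖ ^ 2 - ‖S - T‖ ^ 2) / 4 = ⟪S, T⟫_ℝ := by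
    rw [norm_add_sq_real, norm_sub_sq_real]; ring
  rw [e] at h
  convert! h using 2 with i
  simp only [map_add, map_sub, add_apply, sub_apply]
  rw [norm_add_sq_real, norm_sub_sq_real]; ring

theorem toLp_surjective : Function.Surjective (toLp H) := by
  intro f
  have hf : Summable fun i => ‖f i‖ ^ 2 := by
    simpa using (lp.memℓp f).summable (by norm_num)
  have hle : ∀ y i, ‖⟪f i, y⟫_ℝ‖ ^ 2 ≤ ‖f i‖ ^ 2 * ‖y‖ ^ 2 := fun y i => by
    rw [← mul_pow]
    exact pow_le_pow_left₀ (norm_nonneg _) (norm_inner_le_norm _ _) 2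
  have hsum : ∀ y, Summable fun i => ‖⟪f i, y⟫_ℝ‖ ^ 2 := fun y =>
    Summable.of_nonneg_of_le (fun _ => sq_nonneg _) (hle y) (hf.mul_right _)
  have hmem : ∀ y, Memℓp (fun i => ⟪f i, y⟫_ℝ) 2 := fun y =>
    memℓp_gen (by simpa using hsum y)
  let S₀ : H →ₗ[ℝ] lp (fun _ : hsIndex H => ℝ) 2 :=
    { toFun := fun y => ⟨fun i => ⟪f i, y⟫_ℝ, hmem y⟩
      map_add' := fun x y => by ext i; exact inner_add_right _ _ _
      map_smul' := fun r y => by ext i; exact inner_smul_right _ _ _ }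
  let S : H →L[ℝ] lp (fun _ : hsIndex H => ℝ) 2 := S₀.mkContinuous (‖f‖) (fun y => by
    refine (sq_le_sq₀ (norm_nonneg _) (by positivity)).1 ?_
    have h1 : ‖S₀ y‖ ^ 2 = ∑' i, ‖⟪f i, y⟫_ℝ‖ ^ 2 := by
      have e : ∀ i, S₀ y i = ⟪f i, y⟫_ℝ := fun _ => rfl
      simpa [e] using lp.norm_rpow_eq_tsum (p := 2) (by norm_num) (S₀ y)
    have h2 : ‖f‖ ^ 2 = ∑' i, ‖f i‖ ^ 2 := by
      simpa using lp.norm_rpow_eq_tsum (p := 2) (by norm_num) f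
    rw [h1, mul_pow, h2, ← tsum_mul_right]
    exact (hsum y).tsum_le_tsum (hle y) (hf.mul_right _))
  let R : H →L[ℝ] H := ((hsBasis H).repr.symm : lp (fun _ : hsIndex H => ℝ) 2 →L[ℝ] H) ∘L S
  have hR : ∀ i, ContinuousLinearMap.adjoint R (hsBasis H i) = f i := fun i => by
    refine ext_inner_right ℝ fun y => ?_
    rw [ContinuousLinearMap.adjoint_inner_left, ← HilbertBasis.repr_apply_apply]
    change (hsBasis H).repr ((hsBasis H).repr.symm (S y)) i = _
    rw [LinearIsometryEquiv.apply_symm_apply]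
    rfl
  obtain ⟨T, hT⟩ := exists_toCLM_eq (T := ContinuousLinearMap.adjoint R) (by
    simpa only [IsHilbertSchmidt, hR] using hf)
  refine ⟨T, ?_⟩
  ext i
  rw [toLp_apply, hT, hR]

instance : CompleteSpace (HilbertSchmidt H) := by
  have hi : IsUniformInducing (toLp H) := toLpₗᵢ.isometry.isUniformInducing
  refine (completeSpace_iff_isComplete_range hi).2 ?_
  rw [Set.range_eq_univ.2 toLp_surjective]
  exact isComplete_univ

instance : MeasurableSpace (HilbertSchmidt H) := borel _

instance : BorelSpace (HilbertSchmidt H) := ⟨rfl⟩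

/-- `T` is non-negative definite: `(T f, f) ≥ 0` for all `f`. Self-adjointness is not included
(over the reals it is not implied). -/
def NonnegDef (T : HilbertSchmidt H) : Prop := ∀ f : H, 0 ≤ ⟪T f, f⟫_ℝ

end HilbertSchmidt

end HilbertSchmidt

/-! ### Lévy processes and the Ornstein–Uhlenbeck dynamics -/

section Levy

variable {Ω E : Type*} [MeasurableSpace Ω] [NormedAddCommGroup E] [NormedSpace ℝ E]

/-- `E`-valued Lévy processes: started at zero, with independent and stationary increments,
stochastically continuous. -/
structure IsLevyProcess [MeasurableSpace E] (L : ℝ≥0 → Ω → E) (P : Measure Ω) : Prop where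
  measurable : ∀ t, Measurable (L t)
  zero : ∀ᵐ ω ∂P, L 0 ω = 0
  indep : HasIndepIncrements L P
  stationary : ∀ s t, IdentDistrib (fun ω => L (s + t) ω - L s ω) (L t) P P
  stochContinuous : ∀ t, TendstoInMeasure P L (𝓝 t) (L t)

/-- `Z` is the stochastic integral `∫₀ᵗ Φ(s) dL(s)` of a norm-continuous deterministic integrand
`Φ`: the limit in `L²(Ω; E)` of the sums `∑ Φ(sₘ) (L(sₘ₊₁) - L(sₘ))` over the partitions
`0 = s₀ ≤ s₁ ≤ … ≤ sₙ = t`, as the mesh tends to zero. -/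
def IsStochIntegral (Φ : ℝ≥0 → E →L[ℝ] E) (L : ℝ≥0 → Ω → E) (t : ℝ≥0) (Z : Ω → E)
    (P : Measure Ω) : Prop :=
  MemLp Z 2 P ∧
    ∀ ε : ℝ≥0∞, 0 < ε → ∃ δ : ℝ≥0, 0 < δ ∧
      ∀ (n : ℕ) (s : ℕ → ℝ≥0), Monotone s → s 0 = 0 → s n = t →
        (∀ m < n, s (m + 1) - s m < δ) →
        eLpNorm (fun ω => (∑ m ∈ Finset.range n, Φ (s m) (L (s (m + 1)) ω - L (s m) ω)) - Z ω)
          2 P ≤ ε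

/-- The uniformly continuous semigroup `t ↦ exp (t C)` generated by the bounded operator `C`. -/
def opSemigroup (C : E →L[ℝ] E) (t : ℝ≥0) : E →L[ℝ] E := NormedSpace.exp ((t : ℝ) • C)

/-- `Y` is a mild solution of `dY = C Y dt + dL`, `Y(0) = Y₀`: for every `t`, almost surely,
`Y(t) = S(t) Y₀ + ∫₀ᵗ S(t - s) dL(s)`, where `S(t) = exp (t C)`. -/
def IsMildSolution (C : E →L[ℝ] E) (L : ℝ≥0 → Ω → E) (Y₀ : E) (Y : ℝ≥0 → Ω → E)
    (P : Measure Ω) : Prop :=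
  ∀ t, ∃ Z : Ω → E, IsStochIntegral (fun s => opSemigroup C (t - s)) L t Z P ∧
    ∀ᵐ ω ∂P, Y t ω = opSemigroup C t Y₀ + Z ω

/-- `Y` satisfies the dynamics `dY = C Y dt + dL`, `Y(0) = Y₀` in integrated form: almost surely,
`Y(t) = Y₀ + ∫₀ᵗ C Y(s) ds + L(t)` for all `t ≥ 0`, with a Bochner integral. -/
def IsStrongSolution (C : E →L[ℝ] E) (L : ℝ≥0 → Ω → E) (Y₀ : E) (Y : ℝ≥0 → Ω → E)
    (P : Measure Ω) : Prop :=
  ∀ᵐ ω ∂P, ∀ t : ℝ≥0,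
    IntervalIntegrable (fun s : ℝ => Y s.toNNReal ω) volume 0 t ∧
      Y t ω = Y₀ + (∫ s in (0 : ℝ)..t, C (Y s.toNNReal ω)) + L t ω

variable {H : Type*} [NormedAddCommGroup H] [InnerProductSpace ℝ H] [CompleteSpace H]

/-- Non-decreasing paths: every `L(t)` is almost surely self-adjoint, and for every `f` the path
`t ↦ (L(t) f, f)` is almost surely non-decreasing. -/
def HasNondecreasingPaths (L : ℝ≥0 → Ω → HilbertSchmidt H) (P : Measure Ω) : Prop :=
  (∀ t, ∀ᵐ ω ∂P, IsSelfAdjoint (HilbertSchmidt.toCLM H (L t ω))) ∧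
    ∀ f : H, ∀ᵐ ω ∂P, Monotone fun t => ⟪L t ω f, f⟫_ℝ

end Levy

end

/-!
The cone `𝓗₊` of non-negative definite operators is cut out of the Hilbert–Schmidt operators by the
functionals `T ↦ ⟪T f, f⟫`, which are continuous because the Hilbert–Schmidt norm dominates the
operator norm. If `C` preserves the cone, so does `S(t) = exp (t C)`, term by term in the
exponential series; thus only the positivity of the semigroup matters. By separability of `H`,
almost surely all increments `L(s) - L(r)`, `r ≤ s`, lie in the cone simultaneously
(`HilbertSchmidt.ae_nonnegDef_sub`).

*Mild solutions.* The sums defining the stochastic integral lie in the cone, and a sequence of them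
converges almost surely (`HilbertSchmidt.ae_nonnegDef_of_isStochIntegral`).

*Strong solutions.* The argument is pathwise. No regularity of the path `ℓ = L(·, ω)` is available
beyond integrability, which follows from that of `Y`. With `J = ∫₀ᵗ S(t - s) ℓ(s) ds`, variation of
constants gives `Y(t) = S(t) Y₀ + ℓ(t) + C J` (`eq_opGroup_apply_add_of_eq_integral`); it rests on
an integration by parts for merely integrable functions, obtained from Fubini's theorem. It remains
to see that `ℓ(t) + C J` is in the cone (`apply_add_map_integral_opGroup_nonneg`). Formally this is
`∫₀ᵗ S(t - s) dℓ(s)`. Let `m` be the path `ℓ` frozen after time `t` and zero before time `0`. Then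
`∫ S(t - s) (m(s + h) - m(s)) ds` over `[-h, t]` is in the cone, and translation shows it to be
`F(h) - F(0)` with `F(h) = S(h) J + ∫₀ʰ S(u) ℓ(t) du`. Since `F'(0) = C J + ℓ(t)`, division by `h`
and the limit `h → 0` give the claim. Freezing `m` at `t` is what produces `ℓ(t)` itself rather than
a right limit.
-/

noncomputable section

/-! ### Integration by parts for integrable functions -/

section Integration

variable {E : Type*} [NormedAddCommGroup E] [NormedSpace ℝ E]

theorem MeasureTheory.Integrable.clm_apply_of_norm_le {α : Type*} [MeasurableSpace α]
    {μ : Measure α} {K : α → E →L[ℝ] E} {F : α → E} {B : ℝ} (hF : Integrable F μ)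
    (hK : AEStronglyMeasurable K μ) (hB : ∀ᵐ a ∂μ, ‖K a‖ ≤ B) :
    Integrable (fun a => K a (F a)) μ := by
  refine (hF.norm.const_mul B).mono'
    ((ContinuousLinearMap.id ℝ (E →L[ℝ] E)).aestronglyMeasurable_comp₂ hK hF.1) ?_
  filter_upwards [hB] with a ha
  exact ((K a).le_opNorm _).trans (by gcongr)

theorem IntervalIntegrable.continuous_clm_apply {K : ℝ → E →L[ℝ] E} {F : ℝ → E} {a b : ℝ}
    (hF : IntervalIntegrable F volume a b) (hK : Continuous K) :
    IntervalIntegrable (fun s => K s (F s)) volume a b := by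
  obtain ⟨B, hB⟩ := (isCompact_uIcc (a := a) (b := b)).exists_bound_of_continuousOn
    hK.continuousOn
  rw [intervalIntegrable_iff] at hF ⊢
  refine hF.clm_apply_of_norm_le (B := B) hK.aestronglyMeasurable ?_
  filter_upwards [ae_restrict_mem measurableSet_uIoc] with s hs
  exact hB s (Set.uIoc_subset_uIcc hs)

theorem HasDerivAt.apply_const {K : ℝ → E →L[ℝ] E} {K' : E →L[ℝ] E} {s : ℝ}
    (h : HasDerivAt K K' s) (x : E) : HasDerivAt (fun s => K s x) (K' x) s := by
  simpa using h.clm_apply (hasDerivAt_const s x)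

/-- Integration by parts of a `C¹` operator-valued function against the primitive of a merely
integrable function; it is Fubini's theorem on the triangle `{r ≤ s}`. -/
theorem intervalIntegral_clm_apply_eq_sub [CompleteSpace E] {K K' : ℝ → E →L[ℝ] E} {F : ℝ → E}
    {t : ℝ} (ht : 0 ≤ t) (hK : ∀ s, HasDerivAt K (K' s) s) (hK' : Continuous K')
    (hF : IntervalIntegrable F volume 0 t) :
    ∫ s in 0..t, K s (F s) = K t (∫ s in 0..t, F s) - ∫ s in 0..t, K' s (∫ r in 0..s, F r) := by
  have hKc : Continuous K := continuous_iff_continuousAt.2 fun s => (hK s).continuousAt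
  set Φ : ℝ → ℝ → E := fun r s => Set.indicator {p : ℝ × ℝ | p.1 ≤ p.2}
    (fun p => K' p.2 (F p.1)) (r, s) with hΦ
  have hswap : ∫ r in 0..t, ∫ s in 0..t, Φ r s = ∫ s in 0..t, ∫ r in 0..t, Φ r s := by
    refine intervalIntegral_intervalIntegral_swap ?_
    obtain ⟨B, hB⟩ := (isCompact_uIcc (a := (0 : ℝ)) (b := t)).exists_bound_of_continuousOn
      hK'.continuousOn
    rw [intervalIntegrable_iff] at hF
    refine Integrable.indicator ?_ (measurableSet_le measurable_fst measurable_snd)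
    have : IsFiniteMeasure (volume.restrict (Set.uIoc 0 t)) :=
      isFiniteMeasure_restrict.2 (by simp [Real.volume_uIoc])
    rw [Measure.volume_eq_prod, ← Measure.prod_restrict]
    refine Integrable.clm_apply_of_norm_le (B := B) (K := fun p : ℝ × ℝ => K' p.2)
      (hF.comp_fst _) (hK'.comp continuous_snd).aestronglyMeasurable ?_
    rw [Measure.prod_restrict]
    filter_upwards [ae_restrict_mem (measurableSet_uIoc.prod measurableSet_uIoc)] with p hp
    exact hB _ (Set.uIoc_subset_uIcc hp.2)
  have hleft : ∫ r in 0..t, ∫ s in 0..t, Φ r s = ∫ r in 0..t, (K t (F r) - K r (F r)) := by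
    refine intervalIntegral.integral_congr_ae (ae_of_all _ fun r hr => ?_)
    rw [Set.uIoc_of_le ht] at hr
    have h1 : ∀ s, Φ r s = (Set.Ici r).indicator (fun s => K' s (F r)) s := fun s => by
      simp [hΦ, Set.indicator]
    have h2 : Set.Ioc 0 t ∩ Set.Ici r = Set.Icc r t := by
      ext s
      simp only [Set.mem_inter_iff, Set.mem_Ioc, Set.mem_Ici, Set.mem_Icc]
      exact ⟨fun h => ⟨h.2, h.1.2⟩, fun h => ⟨⟨hr.1.trans_le h.1, h.2⟩, h.1⟩⟩
    simp only [h1]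
    rw [intervalIntegral.integral_of_le ht, setIntegral_indicator measurableSet_Ici, h2,
      integral_Icc_eq_integral_Ioc, ← intervalIntegral.integral_of_le hr.2]
    exact intervalIntegral.integral_eq_sub_of_hasDerivAt
      (fun s _ => (hK s).apply_const (F r))
      ((hK'.clm_apply continuous_const).intervalIntegrable _ _)
  have hright : ∫ s in 0..t, ∫ r in 0..t, Φ r s = ∫ s in 0..t, K' s (∫ r in 0..s, F r) := by
    refine intervalIntegral.integral_congr_ae (ae_of_all _ fun s hs => ?_)
    rw [Set.uIoc_of_le ht] at hs
    have h1 : ∀ r, Φ r s = {r | r ≤ s}.indicator (fun r => K' s (F r)) r := fun r => by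
      simp [hΦ, Set.indicator]
    simp only [h1]
    rw [intervalIntegral.integral_indicator ⟨hs.1.le, hs.2⟩]
    refine (K' s).intervalIntegral_comp_comm (hF.mono_set ?_)
    rw [Set.uIcc_of_le hs.1.le, Set.uIcc_of_le ht]
    exact Set.Icc_subset_Icc_right hs.2
  rw [← hright, ← hswap, hleft, intervalIntegral.integral_sub
    (hF.continuous_clm_apply continuous_const) (hF.continuous_clm_apply hKc),
    (K t).intervalIntegral_comp_comm hF]
  abel

end Integration

/-! ### Variation of constants and positivity for integrable driving paths -/

section Semigroup

variable {E : Type*} [NormedAddCommGroup E] [NormedSpace ℝ E]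

/-- The group `r ↦ exp (r C)`, extending `opSemigroup C` to real times. -/
def opGroup (C : E →L[ℝ] E) (r : ℝ) : E →L[ℝ] E := NormedSpace.exp (r • C)

variable (C : E →L[ℝ] E)

theorem opGroup_zero : opGroup C 0 = 1 := by simp [opGroup]

theorem opGroup_add [CompleteSpace E] (r s : ℝ) : opGroup C (r + s) = opGroup C r * opGroup C s := by
  rw [opGroup, add_smul]
  let := NormedAlgebra.restrictScalars ℚ ℝ (E →L[ℝ] E)
  exact NormedSpace.exp_add_of_commute (((Commute.refl C).smul_left r).smul_right s)

theorem opGroup_add_apply [CompleteSpace E] (r s : ℝ) (x : E) :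
    opGroup C (r + s) x = opGroup C r (opGroup C s x) := by
  rw [opGroup_add]; rfl

theorem opGroup_apply_comm (r : ℝ) (x : E) : opGroup C r (C x) = C (opGroup C r x) :=
  congrArg (fun A : E →L[ℝ] E => A x)
    (((Commute.refl C).smul_left r).exp_left : Commute (opGroup C r) C).eq

theorem hasDerivAt_opGroup [CompleteSpace E] (r : ℝ) : HasDerivAt (opGroup C) (opGroup C r * C) r :=
  hasDerivAt_exp_smul_const C r

theorem continuous_opGroup [CompleteSpace E] : Continuous (opGroup C) :=
  continuous_iff_continuousAt.2 fun r => (hasDerivAt_opGroup C r).continuousAt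

theorem hasDerivAt_opGroup_sub [CompleteSpace E] (t s : ℝ) :
    HasDerivAt (fun s => opGroup C (t - s)) (-(opGroup C (t - s) * C)) s := by
  simpa [Function.comp_def] using
    (hasDerivAt_opGroup C (t - s)).scomp s ((hasDerivAt_id s).const_sub t)

theorem continuous_opGroup_sub [CompleteSpace E] (t : ℝ) : Continuous fun s => opGroup C (t - s) :=
  (continuous_opGroup C).comp (continuous_const.sub continuous_id)

/-- Variation of constants for an integrable driving path. -/
theorem eq_opGroup_apply_add_of_eq_integral [CompleteSpace E] {C : E →L[ℝ] E}
    {y ℓ : ℝ → E} {y₀ : E} {t : ℝ} (ht : 0 ≤ t) (hy : IntervalIntegrable y volume 0 t)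
    (heq : ∀ s ∈ Set.Icc 0 t, y s = y₀ + C (∫ r in 0..s, y r) + ℓ s) :
    y t = opGroup C t y₀ + ℓ t + C (∫ s in 0..t, opGroup C (t - s) (ℓ s)) := by
  set G : ℝ → E := fun s => ∫ r in 0..s, y r with hG
  have hGi : IntervalIntegrable G volume 0 t := by
    refine ContinuousOn.intervalIntegrable ?_
    exact intervalIntegral.continuousOn_primitive_interval' hy Set.left_mem_uIcc
  have hS := continuous_opGroup_sub C t
  have hparts : ∫ s in 0..t, opGroup C (t - s) (y s)
      = G t + ∫ s in 0..t, opGroup C (t - s) (C (G s)) := by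
    rw [intervalIntegral_clm_apply_eq_sub ht (hasDerivAt_opGroup_sub C t)
      (hS.mul continuous_const).neg hy]
    simp [opGroup_zero, hG]
  have hconst : C (∫ s in 0..t, opGroup C (t - s) y₀) = opGroup C t y₀ - y₀ := by
    rw [← C.intervalIntegral_comp_comm ((hS.clm_apply continuous_const).intervalIntegrable _ _)]
    have := intervalIntegral.integral_eq_sub_of_hasDerivAt (a := 0) (b := t)
      (fun s _ => (hasDerivAt_opGroup_sub C t s).apply_const y₀)
      (((hS.mul continuous_const).neg.clm_apply continuous_const).intervalIntegrable _ _)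
    have e : ∀ s, (-(opGroup C (t - s) * C)) y₀ = -C (opGroup C (t - s) y₀) :=
      fun s => congrArg Neg.neg (opGroup_apply_comm C _ _)
    simp only [e, intervalIntegral.integral_neg, sub_self, opGroup_zero, sub_zero] at this
    rw [← neg_inj, this, neg_sub]
    rfl
  have hCG : IntervalIntegrable (fun s => opGroup C (t - s) (C (G s))) volume 0 t := by
    exact (hGi.continuous_clm_apply (K := fun s => opGroup C (t - s) * C)
      (hS.mul continuous_const))
  have hℓ : ∫ s in 0..t, opGroup C (t - s) (ℓ s)
      = G t - ∫ s in 0..t, opGroup C (t - s) y₀ := by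
    have h1 : ∫ s in 0..t, opGroup C (t - s) (ℓ s) = ∫ s in 0..t, (opGroup C (t - s) (y s)
        - opGroup C (t - s) y₀ - opGroup C (t - s) (C (G s))) := by
      refine intervalIntegral.integral_congr fun s hs => ?_
      rw [Set.uIcc_of_le ht] at hs
      simp only [heq s hs, map_add, hG]
      abel
    have h2 := (hS.clm_apply (continuous_const (y := y₀))).intervalIntegrable (μ := volume) 0 t
    have h3 := hy.continuous_clm_apply hS
    rw [h1, intervalIntegral.integral_sub (h3.sub h2) hCG, intervalIntegral.integral_sub h3 h2,
      hparts]
    abel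
  rw [hℓ, map_sub, hconst, heq t ⟨ht, le_rfl⟩]
  abel

/-- Positivity of the convolution with a non-decreasing path, for the order given by a positive
functional `φ`; the hypothesis `hℓ0` makes the path start from zero, so that a jump at time `0`
counts as an increment. -/
theorem apply_add_map_integral_opGroup_nonneg [CompleteSpace E] {C : E →L[ℝ] E}
    {ℓ : ℝ → E} {t : ℝ} (ht : 0 ≤ t) (φ : E →L[ℝ] ℝ) (hℓ : IntervalIntegrable ℓ volume 0 t) (hℓ0 : ∀ s ≤ 0, ℓ s = 0)
    (hφ : ∀ u r s, 0 ≤ u → r ≤ s → 0 ≤ φ (opGroup C u (ℓ s - ℓ r))) :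
    0 ≤ φ (ℓ t + C (∫ s in 0..t, opGroup C (t - s) (ℓ s))) := by
  set J : E := ∫ s in 0..t, opGroup C (t - s) (ℓ s) with hJ
  -- The claimed value is the right derivative at `0` of `φ ∘ F`, which is minimal over `[0, ∞)`
  -- at `0`.
  set F : ℝ → E := fun h => opGroup C h J + ∫ u in 0..h, opGroup C u (ℓ t) with hF
  have hF' : HasDerivAt F (ℓ t + C J) 0 := by
    have h1 := (hasDerivAt_opGroup C 0).apply_const J
    have h2 := (((continuous_opGroup C).clm_apply (continuous_const (y := ℓ t))).integral_hasStrictDerivAt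
      0 0).hasDerivAt
    exact (h1.add h2).congr_deriv (by simp [opGroup_zero, add_comm])
  have hF0 : F 0 = J := by simp [hF, opGroup_zero]
  have hmin : ∀ h, 0 ≤ h → φ (F 0) ≤ φ (F h) := by
    intro h hh
    -- the path is frozen after time `t`; it vanishes before time `0` by assumption
    set m : ℝ → E := fun s => ℓ (min s t) with hm
    have hm1 : IntervalIntegrable m volume (-h) 0 := by
      refine (intervalIntegrable_const (c := (0 : E))).congr fun s hs => ?_
      rw [Set.uIoc_of_le (by linarith)] at hs
      exact (hℓ0 _ ((min_le_left _ _).trans hs.2)).symm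
    have hm2 : IntervalIntegrable m volume 0 t := by
      refine hℓ.congr fun s hs => ?_
      rw [Set.uIoc_of_le ht] at hs
      simp [hm, min_eq_left hs.2]
    have hm3 : IntervalIntegrable m volume t (t + h) := by
      refine (intervalIntegrable_const (c := ℓ t)).congr fun s hs => ?_
      rw [Set.uIoc_of_le (by linarith)] at hs
      simp [hm, min_eq_right hs.1.le]
    have hS : ∀ c, Continuous fun s => opGroup C (c - s) := continuous_opGroup_sub C
    have hmJ : ∫ s in 0..t, opGroup C (t - s) (m s) = J := by
      refine intervalIntegral.integral_congr fun s hs => ?_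
      rw [Set.uIcc_of_le ht] at hs
      simp [hm, min_eq_left hs.2]
    have e1 : ∫ s in (-h)..t, opGroup C (t - s) (m s) = J := by
      rw [← intervalIntegral.integral_add_adjacent_intervals (hm1.continuous_clm_apply (hS t))
        (hm2.continuous_clm_apply (hS t)), hmJ, intervalIntegral.integral_congr_ae
        (g := fun _ => (0 : E))]
      · simp
      · refine ae_of_all _ fun s hs => ?_
        rw [Set.uIoc_of_le (by linarith)] at hs
        simp [hm, hℓ0 _ ((min_le_left s t).trans hs.2)]
    have e2 : ∫ s in (-h)..t, opGroup C (t - s) (m (s + h)) = F h := by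
      have h1 := intervalIntegral.integral_comp_add_right (a := -h) (b := t)
        (fun s => opGroup C (t + h - s) (m s)) h
      simp only [neg_add_cancel, add_sub_add_right_eq_sub] at h1
      rw [h1, ← intervalIntegral.integral_add_adjacent_intervals
        (hm2.continuous_clm_apply (hS _)) (hm3.continuous_clm_apply (hS _)), hF]
      congr 1
      · rw [← hmJ, ← (opGroup C h).intervalIntegral_comp_comm (hm2.continuous_clm_apply (hS t))]
        refine intervalIntegral.integral_congr fun s _ => ?_
        simp only [← opGroup_add_apply]
        congr 2
        ring
      · have h2 := intervalIntegral.integral_comp_sub_left (a := t) (b := t + h)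
          (fun u => opGroup C u (ℓ t)) (t + h)
        simp only [sub_self, add_sub_cancel_left] at h2
        rw [← h2]
        refine intervalIntegral.integral_congr fun s hs => ?_
        rw [Set.uIcc_of_le (by linarith)] at hs
        simp [hm, min_eq_right hs.1]
    have hi1 : IntervalIntegrable (fun s => opGroup C (t - s) (m s)) volume (-h) t :=
      (hm1.trans hm2).continuous_clm_apply (hS t)
    have hi2 : IntervalIntegrable (fun s => opGroup C (t - s) (m (s + h))) volume (-h) t := by
      have := (hm2.trans hm3).comp_add_right h
      simp only [zero_sub, add_sub_cancel_right] at this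
      exact this.continuous_clm_apply (hS t)
    rw [hF0, ← sub_nonneg, ← map_sub, ← e1, ← e2, ← intervalIntegral.integral_sub hi2 hi1,
      ← φ.intervalIntegral_comp_comm (hi2.sub hi1)]
    refine intervalIntegral.integral_nonneg (by linarith) fun s hs => ?_
    rw [← map_sub]
    exact hφ _ _ _ (sub_nonneg.2 hs.2) (min_le_min_right _ (by linarith))
  have hd := (φ.hasFDerivAt.comp_hasDerivAt (0 : ℝ) hF').hasDerivWithinAt (s := Set.Ioi 0)
  rw [hasDerivWithinAt_iff_tendsto_slope' (by simp)] at hd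
  refine ge_of_tendsto hd ?_
  filter_upwards [self_mem_nhdsWithin] with h hh
  rw [slope_def_field]
  exact div_nonneg (sub_nonneg.2 (hmin h (le_of_lt hh))) (by simpa using le_of_lt hh)

end Semigroup

/-! ### The cone of non-negative definite operators -/

namespace HilbertSchmidt

variable {H : Type*} [NormedAddCommGroup H] [InnerProductSpace ℝ H] [CompleteSpace H]

/-- The Hilbert–Schmidt norm dominates the operator norm. -/
theorem norm_apply_le (T : HilbertSchmidt H) (f : H) : ‖T f‖ ≤ ‖T‖ * ‖f‖ := by
  let b := hsBasis H
  refine (sq_le_sq₀ (norm_nonneg _) (by positivity)).1 ?_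
  -- `‖T f‖² = ∑ ⟪f, T* bᵢ⟫² ≤ ‖f‖² ∑ ‖T* bᵢ‖² = ‖f‖² ‖T‖²`
  refine (ENNReal.ofReal_le_ofReal_iff (by positivity)).1 ?_
  calc ENNReal.ofReal (‖T f‖ ^ 2) = ∑' i, ENNReal.ofReal (⟪T f, b i⟫_ℝ ^ 2) :=
        (b.tsum_enorm_sq _).symm
    _ ≤ ∑' i, ENNReal.ofReal (‖f‖ ^ 2) *
          ENNReal.ofReal (‖ContinuousLinearMap.adjoint (toCLM H T) (b i)‖ ^ 2) := by
        refine ENNReal.tsum_le_tsum fun i => ?_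
        rw [← ENNReal.ofReal_mul (sq_nonneg _), ← mul_pow,
          ← ContinuousLinearMap.adjoint_inner_right]
        exact ENNReal.ofReal_le_ofReal (sq_le_sq.2 (by
          simpa [abs_mul] using abs_real_inner_le_norm f
            (ContinuousLinearMap.adjoint (toCLM H T) (b i))))
    _ = ENNReal.ofReal (‖f‖ ^ 2) * ENNReal.ofReal (‖T‖ ^ 2) := by
        rw [ENNReal.tsum_mul_left, ← tsum_enorm_sq_adjoint b b, ← (hasSum_norm_sq b T).tsum_eq,
          ENNReal.ofReal_tsum_of_nonneg (fun _ => sq_nonneg _) (hasSum_norm_sq b T).summable]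
    _ = ENNReal.ofReal ((‖T‖ * ‖f‖) ^ 2) := by
        rw [← ENNReal.ofReal_mul (sq_nonneg _), ← mul_pow, mul_comm]

/-- The functional `T ↦ ⟪T f, f⟫`. -/
def quadForm (f : H) : HilbertSchmidt H →L[ℝ] ℝ :=
  LinearMap.mkContinuous
    { toFun := fun T => ⟪T f, f⟫_ℝ
      map_add' := fun S T => by simp [inner_add_left]
      map_smul' := fun r T => by simp [inner_smul_left] } (‖f‖ * ‖f‖) fun T => by
    calc ‖⟪T f, f⟫_ℝ‖ ≤ ‖T f‖ * ‖f‖ := norm_inner_le_norm _ _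
      _ ≤ ‖T‖ * ‖f‖ * ‖f‖ := by gcongr; exact norm_apply_le T f
      _ = ‖f‖ * ‖f‖ * ‖T‖ := by ring

theorem quadForm_apply (f : H) (T : HilbertSchmidt H) : quadForm f T = ⟪T f, f⟫_ℝ := rfl

theorem nonnegDef_iff_quadForm {T : HilbertSchmidt H} : T.NonnegDef ↔ ∀ f, 0 ≤ quadForm f T :=
  Iff.rfl

theorem NonnegDef.add {S T : HilbertSchmidt H} (hS : S.NonnegDef) (hT : T.NonnegDef) :
    (S + T).NonnegDef := nonnegDef_iff_quadForm.2 fun f => by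
  rw [map_add]; exact add_nonneg (hS f) (hT f)

theorem NonnegDef.sum {ι : Type*} {s : Finset ι} {T : ι → HilbertSchmidt H}
    (hT : ∀ i ∈ s, (T i).NonnegDef) : (∑ i ∈ s, T i).NonnegDef :=
  nonnegDef_iff_quadForm.2 fun f => by
    rw [map_sum]; exact Finset.sum_nonneg fun i hi => hT i hi f

theorem NonnegDef.of_tendsto {ι : Type*} {l : Filter ι} [l.NeBot] {T : ι → HilbertSchmidt H}
    {S : HilbertSchmidt H} (h : Tendsto T l (𝓝 S)) (hT : ∀ i, (T i).NonnegDef) : S.NonnegDef :=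
  nonnegDef_iff_quadForm.2 fun f =>
    ge_of_tendsto' (((quadForm f).continuous.tendsto S).comp h) fun i => hT i f

/-- A bounded operator preserving the cone generates a semigroup preserving the cone: all terms
of the exponential series do. -/
theorem nonnegDef_opSemigroup_apply {C : HilbertSchmidt H →L[ℝ] HilbertSchmidt H}
    (hC : ∀ T : HilbertSchmidt H, T.NonnegDef → (C T).NonnegDef) (t : ℝ≥0)
    {T : HilbertSchmidt H} (hT : T.NonnegDef) : (opSemigroup C t T).NonnegDef := by
  have hpow : ∀ n : ℕ, ((C ^ n) T).NonnegDef := fun n => by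
    induction n with
    | zero => simpa using hT
    | succ n ih => rw [pow_succ']; exact hC _ ih
  refine nonnegDef_iff_quadForm.2 fun f => ?_
  have hs := (NormedSpace.exp_series_hasSum_exp' (𝕂 := ℝ) ((t : ℝ) • C)).mapL
    ((quadForm f).comp (ContinuousLinearMap.apply ℝ (HilbertSchmidt H) T))
  refine hs.nonneg fun n => ?_
  have e : ((quadForm f).comp (ContinuousLinearMap.apply ℝ (HilbertSchmidt H) T))
      (((n.factorial : ℝ)⁻¹) • ((t : ℝ) • C) ^ n)
      = (n.factorial : ℝ)⁻¹ * ((t : ℝ) ^ n * quadForm f ((C ^ n) T)) := by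
    simp [smul_pow]
  rw [e]
  have := hpow n f
  rw [← quadForm_apply] at this
  positivity

/-! ### Processes with non-decreasing paths -/

variable [TopologicalSpace.SeparableSpace H] {Ω : Type*} [MeasurableSpace Ω] {P : Measure Ω}

/-- By separability, the exceptional null sets can be chosen independently of the vector `f`. -/
theorem ae_nonnegDef_sub {L : ℝ≥0 → Ω → HilbertSchmidt H} (hL : HasNondecreasingPaths L P) :
    ∀ᵐ ω ∂P, ∀ r s, r ≤ s → (L s ω - L r ω).NonnegDef := by
  obtain ⟨D, hDc, hD⟩ := TopologicalSpace.exists_countable_dense H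
  filter_upwards [(ae_ball_iff hDc).2 fun f _ => hL.2 f] with ω hω r s hrs
  have hcont : Continuous fun f : H => ⟪(L s ω - L r ω) f, f⟫_ℝ :=
    (toCLM H (L s ω - L r ω)).continuous.inner continuous_id
  refine hD.induction (P := fun f => 0 ≤ ⟪(L s ω - L r ω) f, f⟫_ℝ) (fun f hf => ?_)
    (isClosed_le continuous_const hcont)
  rw [map_sub, sub_apply, inner_sub_left]
  exact sub_nonneg.2 (hω f hf hrs)

/-- Stochastic integrals of cone-preserving integrands against a process with non-decreasing
paths are almost surely non-negative definite. -/
theorem ae_nonnegDef_of_isStochIntegral {L : ℝ≥0 → Ω → HilbertSchmidt H}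
    (hL2 : ∀ t, MemLp (L t) 2 P) (hL : HasNondecreasingPaths L P)
    {Φ : ℝ≥0 → HilbertSchmidt H →L[ℝ] HilbertSchmidt H} {t : ℝ≥0}
    (hΦ : ∀ s, ∀ T : HilbertSchmidt H, T.NonnegDef → (Φ s T).NonnegDef)
    {Z : Ω → HilbertSchmidt H} (hZ : IsStochIntegral Φ L t Z P) : ∀ᵐ ω ∂P, (Z ω).NonnegDef := by
  -- the uniform partition of `[0, t]` into `N + 1` intervals
  let s : ℕ → ℕ → ℝ≥0 := fun N m => m * (t / (N + 1))
  have hs : ∀ N, Monotone (s N) := fun N m n hmn => by dsimp only [s]; gcongr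
  let X : ℕ → Ω → HilbertSchmidt H := fun N ω =>
    ∑ m ∈ Finset.range (N + 1), Φ (s N m) (L (s N (m + 1)) ω - L (s N m) ω)
  have hX : ∀ N, AEStronglyMeasurable (X N) P := fun N =>
    Finset.aestronglyMeasurable_fun_sum _ fun m _ =>
      (Φ (s N m)).continuous.comp_aestronglyMeasurable ((hL2 _).1.sub (hL2 _).1)
  have hmesh : Tendsto (fun N : ℕ => t / ((N : ℝ≥0) + 1)) atTop (𝓝 0) := by
    have := (tendsto_one_div_add_atTop_nhds_zero_nat (𝕜 := ℝ≥0)).const_mul t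
    simpa [div_eq_mul_inv] using this
  have hlim : Tendsto (fun N => eLpNorm (X N - Z) 2 P) atTop (𝓝 0) := by
    rw [ENNReal.tendsto_atTop_zero]
    intro ε hε
    obtain ⟨δ, hδ, hsum⟩ := hZ.2 ε hε
    obtain ⟨N₀, hN₀⟩ := eventually_atTop.1 (hmesh.eventually (gt_mem_nhds hδ))
    refine ⟨N₀, fun N hN => hsum (N + 1) (s N) (hs N) (by simp [s]) ?_ fun m _ => ?_⟩
    · simp only [s, Nat.cast_add, Nat.cast_one]
      exact mul_div_cancel₀ t (by positivity)
    · refine lt_of_eq_of_lt ?_ (hN₀ N hN)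
      simp only [s, Nat.cast_add, Nat.cast_one, add_mul, one_mul, add_tsub_cancel_left]
  obtain ⟨ns, -, hns⟩ := (tendstoInMeasure_of_tendsto_eLpNorm (by norm_num) hX hZ.1.1
    hlim).exists_seq_tendsto_ae
  filter_upwards [hns, ae_nonnegDef_sub hL] with ω hω hmono
  exact NonnegDef.of_tendsto hω fun i =>
    NonnegDef.sum fun m _ => hΦ _ _ (hmono _ _ (hs _ (Nat.le_succ m)))

end HilbertSchmidt

end

theorem mainTheorem3 {H : Type*} [NormedAddCommGroup H] [InnerProductSpace ℝ H] [CompleteSpace H]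
    [TopologicalSpace.SeparableSpace H]
    {Ω : Type*} [MeasurableSpace Ω] (P : Measure Ω) [IsProbabilityMeasure P]
    (C : HilbertSchmidt H →L[ℝ] HilbertSchmidt H)
    (hC : (∀ T : HilbertSchmidt H, T.NonnegDef → (C T).NonnegDef) ∨
      (∀ (t : ℝ≥0) (T : HilbertSchmidt H), T.NonnegDef → (opSemigroup C t T).NonnegDef))
    (L : ℝ≥0 → Ω → HilbertSchmidt H) (hL : IsLevyProcess L P) (hL2 : ∀ t, MemLp (L t) 2 P)
    (hLmono : HasNondecreasingPaths L P)
    (Y₀ : HilbertSchmidt H) (hY₀ : Y₀.NonnegDef)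
    (Y : ℝ≥0 → Ω → HilbertSchmidt H) :
    (IsMildSolution C L Y₀ Y P → ∀ t, ∀ᵐ ω ∂P, (Y t ω).NonnegDef) ∧
      (IsStrongSolution C L Y₀ Y P → ∀ᵐ ω ∂P, ∀ t, (Y t ω).NonnegDef) := by
  have hS : ∀ (t : ℝ≥0) (T : HilbertSchmidt H), T.NonnegDef → (opSemigroup C t T).NonnegDef :=
    hC.elim (fun h t T hT => HilbertSchmidt.nonnegDef_opSemigroup_apply h t hT) id
  refine ⟨fun hY t => ?_, fun hY => ?_⟩
  · obtain ⟨Z, hZ, hYZ⟩ := hY t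
    filter_upwards [hYZ, HilbertSchmidt.ae_nonnegDef_of_isStochIntegral hL2 hLmono
      (fun s T hT => hS (t - s) T hT) hZ] with ω hω hZω
    rw [hω]
    exact (hS t Y₀ hY₀).add hZω
  · filter_upwards [hY, HilbertSchmidt.ae_nonnegDef_sub hLmono, hL.zero] with ω hω hmono h0 t
    set y : ℝ → HilbertSchmidt H := fun s => Y s.toNNReal ω
    set ℓ : ℝ → HilbertSchmidt H := fun s => L s.toNNReal ω
    have hy : IntervalIntegrable y volume 0 t := (hω t).1
    have heq : ∀ s ∈ Set.Icc (0 : ℝ) t, y s = Y₀ + C (∫ r in 0..s, y r) + ℓ s := by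
      intro s hs
      obtain ⟨hi, he⟩ := hω s.toNNReal
      rw [Real.coe_toNNReal s hs.1] at hi he
      rw [← C.intervalIntegral_comp_comm hi]
      exact he
    have hℓ : IntervalIntegrable ℓ volume 0 t := by
      have hG : IntervalIntegrable (fun s => C (∫ r in 0..s, y r)) volume 0 t :=
        (C.continuous.comp_continuousOn
          (intervalIntegral.continuousOn_primitive_interval' hy Set.left_mem_uIcc)).intervalIntegrable
      refine ((hy.sub (intervalIntegrable_const (c := Y₀))).sub hG).congr fun s hs => ?_
      rw [Set.uIoc_of_le t.coe_nonneg] at hs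
      simp only [heq s ⟨hs.1.le, hs.2⟩]
      abel
    have hYt : Y t ω = y t := by simp [y]
    rw [hYt, eq_opGroup_apply_add_of_eq_integral t.coe_nonneg hy heq, add_assoc]
    refine (hS t Y₀ hY₀).add (HilbertSchmidt.nonnegDef_iff_quadForm.2 fun f => ?_)
    refine apply_add_map_integral_opGroup_nonneg t.coe_nonneg _ hℓ
      (fun s hs => by simp [ℓ, Real.toNNReal_of_nonpos hs, h0]) fun u r s hu hrs => ?_
    exact hS ⟨u, hu⟩ _ (hmono _ _ (Real.toNNReal_le_toNNReal hrs)) f
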